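/- For integers $m\ge 1$ and $n\ge 0$ let $H_n^{(m)}=\sum_{0<j\le n} j^{-m}$ and $H_n=H_n^{(1)}$ (so $H_0^{(m)}=0$), let $\zeta$ be the Riemann zeta function, and let $Q(k)=60k^2-43k+8$. Then the following four series converge, with the stated sums: $$\sum_{k=1}^\infty \frac{\binom{4k}{2k}\left(Q(k)\,(3H_{2k-1}-2H_{k-1})-34k+\frac{25}{2}\right)}{(4k-1)\,k^3\binom{2k}{k}^4}=6\zeta(3),$$ $$\sum_{k=1}^\infty \frac{\binom{4k}{2k}\left(Q(k)\,H_{4k-1}-\frac{304k^2-216k+39}{4(4k-1)}\right)}{(4k-1)\,k^3\binom{2k}{k}^4}=4\zeta(3),$$ $$\sum_{k=1}^\infty \frac{\binom{4k}{2k}\left(Q(k)\,H_{k-1}^{(2)}+\frac{44k-15}{4k}\right)}{(4k-1)\,k^3\binom{2k}{k}^4}=\frac{\pi^4}{90},$$ $$\sum_{k=1}^\infty \frac{\binom{4k}{2k}\left(Q(k)\,H_{2k-1}^{(2)}+\frac{52k-21}{4k}\right)}{(4k-1)\,k^3\binom{2k}{k}^4}=\frac{2\pi^4}{45}.$$ 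-/

import Mathlib

namespace HarmonicSeries

/-- The generalized harmonic number `H_n^{(m)} = ∑_{0 < j ≤ n} 1 / j ^ m`
(for `m = 1` this is Mathlib's `harmonic n`). -/
def genHarmonic (m n : ℕ) : ℚ := ∑ j ∈ Finset.Icc 1 n, 1 / (j : ℚ) ^ m

/-- The polynomial `Q(k) = 60 k² - 43 k + 8`. -/
noncomputable def Q (k : ℕ) : ℝ := 60 * (k : ℝ) ^ 2 - 43 * (k : ℝ) + 8

/-- The summand `C(4k,2k) * c / ((4k-1) k³ C(2k,k)⁴)`, where `c` is the factor that varies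
between the identities. It is used only for `k ≥ 1`, where the denominator is positive. -/
noncomputable def summand (k : ℕ) (c : ℝ) : ℝ :=
  ((4 * k).choose (2 * k) : ℝ) * c /
    ((4 * (k : ℝ) - 1) * (k : ℝ) ^ 3 * ((2 * k).choose k : ℝ) ^ 4)

end HarmonicSeries

/-! Two Wilf-Zeilberger pairs `F = w * b`, `G = w * p` (`w` is `weightA` or `weightB`, `p` is
`companionA` or `companionB`) satisfy `F n (k+1) - F n k = G (n+1) k - G n k`. Summing over both
indices gives `∑ k, G 0 k = ∑ n, F n 0` (`hasSum_of_wz`). On the edge `n = 0` the weights coincide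
and both companions equal `Q (k+1) / (8 (2k+1))`, so `G 0 k` is the summand of the theorem without
its harmonic correction.

Harmonic numbers enter by perturbing each pair. Differentiating in `n` multiplies `w` by its
logarithmic derivative, a combination of `H_m`. Splitting squares `m!^2` into `∏ (j^2 - ε^2)` and
taking the coefficient of `ε^2` produces `H_m^{(2)}`. The perturbed identities (`wzADeriv`, `wzASnd`
and their B analogues) are rational and are checked directly. The edge `k = 0` is then elementary,
giving `-4ζ(3)`, `2ζ(4)`, `-12ζ(3)` and `2π^4/15`; the four stated series are linear combinations of
the resulting four. -/

namespace HarmonicSeries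

open Filter Topology Finset

/-! ### Certificates and rational WZ identities -/

/-- The coefficient polynomial of the first certificate. -/
def certA (x y : ℝ) : ℝ :=
  25 + 152 * y + 366 * y ^ 2 + 436 * y ^ 3 + 257 * y ^ 4 + 60 * y ^ 5
    + (76 + 366 * y + 654 * y ^ 2 + 514 * y ^ 3 + 150 * y ^ 4) * x
    + (92 + 330 * y + 390 * y ^ 2 + 152 * y ^ 3) * x ^ 2
    + (56 + 133 * y + 78 * y ^ 2) * x ^ 3 + (17 + 20 * y) * x ^ 4 + 2 * x ^ 5

/-- The derivative of `certA` in its first variable. -/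
def certADeriv (x y : ℝ) : ℝ :=
  76 + 366 * y + 654 * y ^ 2 + 514 * y ^ 3 + 150 * y ^ 4
    + 2 * (92 + 330 * y + 390 * y ^ 2 + 152 * y ^ 3) * x
    + 3 * (56 + 133 * y + 78 * y ^ 2) * x ^ 2 + 4 * (17 + 20 * y) * x ^ 3 + 10 * x ^ 4

/-- The second order coefficient of the deformation of `certA`, up to sign. -/
def certASnd (x y : ℝ) : ℝ :=
  13 + 48 * y + 59 * y ^ 2 + 24 * y ^ 3 + (24 + 59 * y + 36 * y ^ 2) * x
    + (13 + 16 * y) * x ^ 2 + 2 * x ^ 3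

/-- The coefficient polynomial of the second certificate. -/
def certB (x y : ℝ) : ℝ :=
  25 + 152 * y + 366 * y ^ 2 + 436 * y ^ 3 + 257 * y ^ 4 + 60 * y ^ 5
    + (68 + 324 * y + 572 * y ^ 2 + 444 * y ^ 3 + 128 * y ^ 4) * x
    + (63 + 220 * y + 253 * y ^ 2 + 96 * y ^ 3) * x ^ 2
    + (26 + 58 * y + 32 * y ^ 2) * x ^ 3 + (4 + 4 * y) * x ^ 4

/-- The derivative of `certB` in its first variable. -/
def certBDeriv (x y : ℝ) : ℝ :=
  68 + 324 * y + 572 * y ^ 2 + 444 * y ^ 3 + 128 * y ^ 4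
    + 2 * (63 + 220 * y + 253 * y ^ 2 + 96 * y ^ 3) * x
    + 3 * (26 + 58 * y + 32 * y ^ 2) * x ^ 2 + 4 * (4 + 4 * y) * x ^ 3

/-- The second order coefficient of the deformation of `certB`. -/
def certBSnd (x y : ℝ) : ℝ :=
  2 + 12 * y + 18 * y ^ 2 + 8 * y ^ 3 - (4 + 4 * y) * x - x ^ 2

/-- The ratio in the second variable of the first weight. -/
noncomputable def ratioA (x y : ℝ) : ℝ :=
  (2 * x + 4 * y + 3) * (2 * x + 4 * y + 5) * (x + y + 1) ^ 3 * (y + 1) ^ 3 /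
    ((2 * x + 2 * y + 3) * (x + 2 * y + 2) ^ 3 * (x + 2 * y + 3) ^ 3 * (2 * y + 1))

/-- The ratio in the first variable of the first weight. -/
noncomputable def shiftA (x y : ℝ) : ℝ :=
  (2 * x + 4 * y + 3) * (x + y + 1) ^ 3 / ((2 * x + 2 * y + 3) * (x + 2 * y + 2) ^ 3)

/-- The ratio in the second variable of the second weight. -/
noncomputable def ratioB (x y : ℝ) : ℝ :=
  (x + y + 1) ^ 2 * (y + 1) ^ 3 * (4 * y + 3) * (4 * y + 5) /
    (2 * (2 * x + 2 * y + 3) ^ 2 * (x + 2 * y + 2) ^ 2 * (x + 2 * y + 3) ^ 2 * (2 * y + 1))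

/-- The ratio in the first variable of the second weight. -/
noncomputable def shiftB (x y : ℝ) : ℝ :=
  (x + y + 1) ^ 2 * (2 * x + 1) ^ 2 / ((2 * x + 2 * y + 3) ^ 2 * (x + 2 * y + 2) ^ 2)

noncomputable def companionA (x y : ℝ) : ℝ :=
  certA x y / ((2 * y + 1) * (x + 2 * y + 2) ^ 3)

noncomputable def companionADeriv (x y : ℝ) : ℝ :=
  certADeriv x y / ((2 * y + 1) * (x + 2 * y + 2) ^ 3)
    - 3 * certA x y / ((2 * y + 1) * (x + 2 * y + 2) ^ 4)

/-- Coefficient of `ε^2` in `companionA` when `X^3`, `X = x + 2y + 2`, becomes `X (X^2 - ε^2)` and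
`certA` becomes `certA - ε^2 * certASnd`. -/
noncomputable def companionASnd (x y : ℝ) : ℝ :=
  certA x y / ((2 * y + 1) * (x + 2 * y + 2) ^ 5)
    - certASnd x y / ((2 * y + 1) * (x + 2 * y + 2) ^ 3)

noncomputable def companionB (x y : ℝ) : ℝ :=
  certB x y / (2 * (x + 2 * y + 2) ^ 2 * (2 * y + 1) * (y + 1))

noncomputable def companionBDeriv (x y : ℝ) : ℝ :=
  certBDeriv x y / (2 * (x + 2 * y + 2) ^ 2 * (2 * y + 1) * (y + 1))
    - certB x y / ((x + 2 * y + 2) ^ 3 * (2 * y + 1) * (y + 1))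

/-- Here the denominator is left undeformed, so only the numerator contributes. -/
noncomputable def companionBSnd (x y : ℝ) : ℝ :=
  certBSnd x y / (2 * (x + 2 * y + 2) ^ 2 * (2 * y + 1) * (y + 1))

theorem wzA {x y : ℝ} (hx : 0 ≤ x) (hy : 0 ≤ y) :
    ratioA x y * (2 * x + 3 * (y + 1) + 2) - (2 * x + 3 * y + 2)
      = shiftA x y * companionA (x + 1) y - companionA x y := by
  have h1 : x + 1 + 2 * y + 2 = x + 2 * y + 3 := by ring
  simp only [ratioA, shiftA, companionA, h1]
  field_simp
  simp only [certA]
  ring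

/-- The `x`-derivative of `wzA`, with the weight included: the inner brackets are the logarithmic
derivatives of `ratioA` and `shiftA`. -/
theorem wzADeriv {x y : ℝ} (hx : 0 ≤ x) (hy : 0 ≤ y) :
    ratioA x y * (2 + (2 * x + 3 * (y + 1) + 2) *
        (2 / (2 * x + 4 * y + 3) + 2 / (2 * x + 4 * y + 5) - 2 / (2 * x + 2 * y + 3)
          - 3 * (1 / (x + 2 * y + 2) + 1 / (x + 2 * y + 3) - 1 / (x + y + 1)))) - 2
      = shiftA x y * (companionADeriv (x + 1) y + companionA (x + 1) y *
          (2 / (2 * x + 4 * y + 3) - 2 / (2 * x + 2 * y + 3)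
            - 3 * (1 / (x + 2 * y + 2) - 1 / (x + y + 1)))) - companionADeriv x y := by
  have h1 : x + 1 + 2 * y + 2 = x + 2 * y + 3 := by ring
  simp only [ratioA, shiftA, companionA, companionADeriv, h1]
  field_simp
  simp only [certA, certADeriv]
  ring

/-- The `ε^2` part of `wzA`. The affine factor is not deformed, hence the zeros, which keep the
shape required by `hasSum_of_weight`. -/
theorem wzASnd {x y : ℝ} (hx : 0 ≤ x) (hy : 0 ≤ y) :
    ratioA x y * (0 + (2 * x + 3 * (y + 1) + 2) *
        (1 / (x + 2 * y + 2) ^ 2 + 1 / (x + 2 * y + 3) ^ 2 - 1 / (x + y + 1) ^ 2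
          - 1 / (y + 1) ^ 2)) - 0
      = shiftA x y * (companionASnd (x + 1) y + companionA (x + 1) y *
          (1 / (x + 2 * y + 2) ^ 2 - 1 / (x + y + 1) ^ 2)) - companionASnd x y := by
  have h1 : x + 1 + 2 * y + 2 = x + 2 * y + 3 := by ring
  simp only [ratioA, shiftA, companionA, companionASnd, h1]
  field_simp
  simp only [certA, certASnd]
  ring

theorem wzB {x y : ℝ} (hx : 0 ≤ x) (hy : 0 ≤ y) :
    ratioB x y * (4 * x + 4 * (y + 1) + 3) - (4 * x + 4 * y + 3)
      = shiftB x y * companionB (x + 1) y - companionB x y := by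
  have h1 : x + 1 + 2 * y + 2 = x + 2 * y + 3 := by ring
  simp only [ratioB, shiftB, companionB, h1]
  field_simp
  simp only [certB]
  ring

theorem wzBDeriv {x y : ℝ} (hx : 0 ≤ x) (hy : 0 ≤ y) :
    ratioB x y * (4 + (4 * x + 4 * (y + 1) + 3) *
        (2 / (x + y + 1) - 2 / (x + 2 * y + 2) - 2 / (x + 2 * y + 3)
          - 4 / (2 * x + 2 * y + 3))) - 4
      = shiftB x y * (companionBDeriv (x + 1) y + companionB (x + 1) y *
          (2 / (x + y + 1) - 2 / (x + 2 * y + 2) + 4 / (2 * x + 1) - 4 / (2 * x + 2 * y + 3)))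
        - companionBDeriv x y := by
  have h1 : x + 1 + 2 * y + 2 = x + 2 * y + 3 := by ring
  simp only [ratioB, shiftB, companionB, companionBDeriv, h1]
  field_simp
  simp only [certB, certBDeriv]
  ring

theorem wzBSnd {x y : ℝ} (hx : 0 ≤ x) (hy : 0 ≤ y) :
    ratioB x y * (0 + (4 * x + 4 * (y + 1) + 3) *
        (4 / (2 * x + 2 * y + 3) ^ 2 - 1 / (x + y + 1) ^ 2 - 2 / (y + 1) ^ 2)) - 0
      = shiftB x y * (companionBSnd (x + 1) y + companionB (x + 1) y *
          (4 / (2 * x + 2 * y + 3) ^ 2 - 1 / (x + y + 1) ^ 2)) - companionBSnd x y := by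
  have h1 : x + 1 + 2 * y + 2 = x + 2 * y + 3 := by ring
  simp only [ratioB, shiftB, companionB, companionBSnd, h1]
  field_simp
  simp only [certB, certBSnd]
  ring


/-! ### Size estimates, by coefficientwise positivity -/

theorem certA_bounds {x y : ℝ} (hx : 0 ≤ x) (hy : 0 ≤ y) :
    0 ≤ certA x y ∧ certA x y ≤ 60 * (x + 2 * y + 2) ^ 5 := by
  constructor
  · unfold certA; positivity
  · rw [← sub_nonneg]; unfold certA; ring_nf; positivity

theorem certADeriv_bounds {x y : ℝ} (hx : 0 ≤ x) (hy : 0 ≤ y) :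
    0 ≤ certADeriv x y ∧ certADeriv x y ≤ 60 * (x + 2 * y + 2) ^ 4 := by
  constructor
  · unfold certADeriv; positivity
  · rw [← sub_nonneg]; unfold certADeriv; ring_nf; positivity

theorem certASnd_bounds {x y : ℝ} (hx : 0 ≤ x) (hy : 0 ≤ y) :
    0 ≤ certASnd x y ∧ certASnd x y ≤ 60 * (x + 2 * y + 2) ^ 3 := by
  constructor
  · unfold certASnd; positivity
  · rw [← sub_nonneg]; unfold certASnd; ring_nf; positivity

theorem certB_bounds {x y : ℝ} (hx : 0 ≤ x) (hy : 0 ≤ y) :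
    0 ≤ certB x y ∧ certB x y ≤ 60 * ((x + 2 * y + 2) ^ 4 * (y + 1)) := by
  constructor
  · unfold certB; positivity
  · rw [← sub_nonneg]; unfold certB; ring_nf; positivity

theorem certBDeriv_bounds {x y : ℝ} (hx : 0 ≤ x) (hy : 0 ≤ y) :
    0 ≤ certBDeriv x y ∧ certBDeriv x y ≤ 60 * ((x + 2 * y + 2) ^ 3 * (y + 1)) := by
  constructor
  · unfold certBDeriv; positivity
  · rw [← sub_nonneg]; unfold certBDeriv; ring_nf; positivity

theorem abs_certBSnd_le {x y : ℝ} (hx : 0 ≤ x) (hy : 0 ≤ y) :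
    |certBSnd x y| ≤ 60 * ((x + 2 * y + 2) ^ 3 * (y + 1)) := by
  rw [abs_le]
  constructor
  · rw [neg_le_iff_add_nonneg]; unfold certBSnd; ring_nf; positivity
  · rw [← sub_nonneg]; unfold certBSnd; ring_nf; positivity

/-- The ratio tends to `1/16` as `y → ∞` with `x` fixed; any bound below 1 would serve. -/
theorem ratioA_le {x y : ℝ} (hx : 0 ≤ x) (hy : 0 ≤ y) : ratioA x y ≤ 1 / 4 := by
  unfold ratioA
  rw [div_le_div_iff₀ (by positivity) (by norm_num), ← sub_nonneg]
  ring_nf; positivity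

theorem ratioB_le {x y : ℝ} (hx : 0 ≤ x) (hy : 0 ≤ y) : ratioB x y ≤ 1 / 4 := by
  unfold ratioB
  rw [div_le_div_iff₀ (by positivity) (by norm_num), ← sub_nonneg]
  ring_nf; positivity


theorem sq_le_of_nonneg {x y : ℝ} (hx : 0 ≤ x) (hy : 0 ≤ y) :
    (x + 2 * y + 2) ^ 2 ≤ 4 * ((x + 1) ^ 2 * (y + 1) ^ 2) := by
  have h : x + 2 * y + 2 ≤ 2 * ((x + 1) * (y + 1)) := by nlinarith [mul_nonneg hx hy]
  calc (x + 2 * y + 2) ^ 2 ≤ (2 * ((x + 1) * (y + 1))) ^ 2 := by gcongr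
    _ = _ := by ring

/-- The constant `180 = 3 * 60` leaves room for the factor 3 produced by differentiating a cube. -/
theorem abs_div_le_sq {x y N D : ℝ} (hx : 0 ≤ x) (hy : 0 ≤ y) (hD : 0 < D)
    (h : |N| ≤ 180 * ((x + 2 * y + 2) ^ 2 * D)) :
    |N / D| ≤ 720 * ((x + 1) ^ 2 * (y + 1) ^ 2) := by
  rw [abs_div, abs_of_pos hD, div_le_iff₀ hD]
  have := mul_le_mul_of_nonneg_right (sq_le_of_nonneg hx hy) hD.le
  linarith

theorem abs_companionA_le {x y : ℝ} (hx : 0 ≤ x) (hy : 0 ≤ y) :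
    |companionA x y| ≤ 1440 * ((x + 1) ^ 2 * (y + 1) ^ 2) := by
  have h := certA_bounds hx hy
  refine (abs_div_le_sq hx hy (by positivity) ?_).trans (by gcongr; norm_num)
  rw [abs_of_nonneg h.1]
  refine h.2.trans ?_
  rw [← sub_nonneg]; ring_nf; positivity

theorem abs_companionADeriv_le {x y : ℝ} (hx : 0 ≤ x) (hy : 0 ≤ y) :
    |companionADeriv x y| ≤ 1440 * ((x + 1) ^ 2 * (y + 1) ^ 2) := by
  have h := certA_bounds hx hy
  have h' := certADeriv_bounds hx hy
  refine (abs_sub _ _).trans ?_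
  have h1 : |certADeriv x y / ((2 * y + 1) * (x + 2 * y + 2) ^ 3)|
      ≤ 720 * ((x + 1) ^ 2 * (y + 1) ^ 2) := by
    refine abs_div_le_sq hx hy (by positivity) ?_
    rw [abs_of_nonneg h'.1]
    refine h'.2.trans ?_
    rw [← sub_nonneg]; ring_nf; positivity
  have h2 : |3 * certA x y / ((2 * y + 1) * (x + 2 * y + 2) ^ 4)|
      ≤ 720 * ((x + 1) ^ 2 * (y + 1) ^ 2) := by
    refine abs_div_le_sq hx hy (by positivity) ?_
    rw [abs_of_nonneg (mul_nonneg (by norm_num) h.1)]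
    refine (mul_le_mul_of_nonneg_left h.2 (by norm_num)).trans ?_
    rw [← sub_nonneg]; ring_nf; positivity
  linarith

theorem abs_companionASnd_le {x y : ℝ} (hx : 0 ≤ x) (hy : 0 ≤ y) :
    |companionASnd x y| ≤ 1440 * ((x + 1) ^ 2 * (y + 1) ^ 2) := by
  have h := certA_bounds hx hy
  have h' := certASnd_bounds hx hy
  refine (abs_sub _ _).trans ?_
  have h1 : |certASnd x y / ((2 * y + 1) * (x + 2 * y + 2) ^ 3)|
      ≤ 720 * ((x + 1) ^ 2 * (y + 1) ^ 2) := by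
    refine abs_div_le_sq hx hy (by positivity) ?_
    rw [abs_of_nonneg h'.1]
    refine h'.2.trans ?_
    rw [← sub_nonneg]; ring_nf; positivity
  have h2 : |certA x y / ((2 * y + 1) * (x + 2 * y + 2) ^ 5)|
      ≤ 720 * ((x + 1) ^ 2 * (y + 1) ^ 2) := by
    refine abs_div_le_sq hx hy (by positivity) ?_
    rw [abs_of_nonneg h.1]
    refine h.2.trans ?_
    rw [← sub_nonneg]; ring_nf; positivity
  linarith

theorem abs_companionB_le {x y : ℝ} (hx : 0 ≤ x) (hy : 0 ≤ y) :
    |companionB x y| ≤ 1440 * ((x + 1) ^ 2 * (y + 1) ^ 2) := by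
  have h := certB_bounds hx hy
  refine (abs_div_le_sq hx hy (by positivity) ?_).trans (by gcongr; norm_num)
  rw [abs_of_nonneg h.1]
  refine h.2.trans ?_
  rw [← sub_nonneg]; ring_nf; positivity

theorem abs_companionBDeriv_le {x y : ℝ} (hx : 0 ≤ x) (hy : 0 ≤ y) :
    |companionBDeriv x y| ≤ 1440 * ((x + 1) ^ 2 * (y + 1) ^ 2) := by
  have h := certB_bounds hx hy
  have h' := certBDeriv_bounds hx hy
  refine (abs_sub _ _).trans ?_
  have h1 : |certBDeriv x y / (2 * (x + 2 * y + 2) ^ 2 * (2 * y + 1) * (y + 1))|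
      ≤ 720 * ((x + 1) ^ 2 * (y + 1) ^ 2) := by
    refine abs_div_le_sq hx hy (by positivity) ?_
    rw [abs_of_nonneg h'.1]
    refine h'.2.trans ?_
    rw [← sub_nonneg]; ring_nf; positivity
  have h2 : |certB x y / ((x + 2 * y + 2) ^ 3 * (2 * y + 1) * (y + 1))|
      ≤ 720 * ((x + 1) ^ 2 * (y + 1) ^ 2) := by
    refine abs_div_le_sq hx hy (by positivity) ?_
    rw [abs_of_nonneg h.1]
    refine h.2.trans ?_
    rw [← sub_nonneg]; ring_nf; positivity
  linarith

theorem abs_companionBSnd_le {x y : ℝ} (hx : 0 ≤ x) (hy : 0 ≤ y) :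
    |companionBSnd x y| ≤ 1440 * ((x + 1) ^ 2 * (y + 1) ^ 2) := by
  refine (abs_div_le_sq hx hy (by positivity) ?_).trans (by gcongr; norm_num)
  refine (abs_certBSnd_le hx hy).trans ?_
  rw [← sub_nonneg]; ring_nf; positivity

/-! ### Summation principle for WZ pairs -/

/-- Summation by a Wilf-Zeilberger pair with geometric decay in the second variable. -/
theorem hasSum_of_wz {F G : ℕ → ℕ → ℝ} {C S : ℝ}
    (hwz : ∀ n k, F n (k + 1) - F n k = G (n + 1) k - G n k)
    (hF : ∀ n k : ℕ, |F n k| ≤ C * (((k : ℝ) + 1) ^ 3 * (1 / 4) ^ k) * (1 / ((n : ℝ) + 1) ^ 2))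
    (hG : ∀ n k : ℕ, |G n k| ≤ C * (((k : ℝ) + 1) ^ 3 * (1 / 4) ^ k) * (1 / ((n : ℝ) + 1)))
    (hS : Tendsto (fun N => ∑ n ∈ range N, F n 0) atTop (𝓝 S)) :
    HasSum (fun k => G 0 k) S := by
  have hgeo : Summable fun k : ℕ => ((k : ℝ) + 1) ^ 3 * (1 / 4 : ℝ) ^ k := by
    have := (summable_nat_add_iff 1).2
      (summable_pow_mul_geometric_of_norm_lt_one (R := ℝ) 3 (r := 1 / 4) (by norm_num))
    refine (this.mul_left 4).congr fun k => ?_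
    push_cast; ring
  have hsq : Summable fun n : ℕ => 1 / ((n : ℝ) + 1) ^ 2 := by
    have := (summable_nat_add_iff 1).2 (Real.summable_one_div_nat_pow.2 one_lt_two)
    exact this.congr fun n => by push_cast; rfl
  have hFs : ∀ k, Summable fun n => F n k := fun k =>
    Summable.of_norm_bounded (hsq.mul_left _) fun n => hF n k
  have hGs : Summable fun k => G 0 k :=
    Summable.of_norm_bounded (hgeo.mul_left C) fun k => by
      simpa [mul_assoc] using hG 0 k
  have hGlim : ∀ k, Tendsto (fun n => G n k) atTop (𝓝 0) := fun k => by
    refine squeeze_zero_norm (fun n => hG n k) ?_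
    simpa using (tendsto_one_div_add_atTop_nhds_zero_nat (𝕜 := ℝ)).const_mul
      (C * (((k : ℝ) + 1) ^ 3 * (1 / 4) ^ k))
  -- Summing the WZ relation over `n` telescopes the right side to `-G 0 k`; the column sums of `F`
  -- then telescope in `k`.
  have hstep : ∀ k, G 0 k = ∑' n, F n k - ∑' n, F n (k + 1) := fun k => by
    have h1 : Tendsto (fun N => ∑ n ∈ range N, (F n (k + 1) - F n k)) atTop
        (𝓝 (∑' n, F n (k + 1) - ∑' n, F n k)) :=
      ((hFs (k + 1)).hasSum.sub (hFs k).hasSum).tendsto_sum_nat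
    have h2 : Tendsto (fun N => ∑ n ∈ range N, (F n (k + 1) - F n k)) atTop (𝓝 (0 - G 0 k)) := by
      simp only [hwz, Finset.sum_range_sub (fun n => G n k)]
      exact (hGlim k).sub_const _
    linarith [tendsto_nhds_unique h1 h2]
  have h0 : ∑' n, F n 0 = S := tendsto_nhds_unique (hFs 0).hasSum.tendsto_sum_nat hS
  have hlim : Tendsto (fun k => ∑' n, F n k) atTop (𝓝 0) := by
    have : Tendsto (fun k : ℕ => C * (((k : ℝ) + 1) ^ 3 * (1 / 4) ^ k) *
        ∑' n : ℕ, 1 / ((n : ℝ) + 1) ^ 2) atTop (𝓝 0) := by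
      simpa using (hgeo.tendsto_atTop_zero.const_mul C).mul_const _
    refine squeeze_zero_norm (fun k => ?_) this
    exact tsum_of_norm_bounded (hsq.hasSum.mul_left _) fun n => hF n k
  refine (hGs.hasSum_iff_tendsto_nat).2 ?_
  have : (fun K => ∑ k ∈ range K, G 0 k) = fun K => S - ∑' n, F n K := by
    funext K
    simp only [hstep, Finset.sum_range_sub', h0]
  rw [this]
  simpa using hlim.const_sub S

/-- The form of `hasSum_of_wz` for a weight `w` times an affine function of `l`. -/
theorem hasSum_of_weight {w l : ℕ → ℕ → ℝ} {a : ℝ} {b p q ρ σ δ ε : ℝ → ℝ → ℝ} {S : ℝ}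
    (hw0 : ∀ n k, 0 ≤ w n k)
    (hw : ∀ n : ℕ, w n 0 ≤ 1 / ((n : ℝ) + 1) ^ 3)
    (hρ : ∀ x y : ℝ, 0 ≤ x → 0 ≤ y → ρ x y ≤ 1 / 4)
    (hwk : ∀ n k : ℕ, w n (k + 1) = w n k * ρ n k)
    (hwn : ∀ n k : ℕ, w (n + 1) k = w n k * σ n k)
    (hlk : ∀ n k : ℕ, l n (k + 1) = l n k + δ n k)
    (hln : ∀ n k : ℕ, l (n + 1) k = l n k + ε n k)
    (hl : ∀ n k : ℕ, |l n k| ≤ 20 * ((k : ℝ) + 1))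
    (ha : |a| ≤ 4)
    (hb : ∀ x y : ℝ, 0 ≤ x → 0 ≤ y → |b x y| ≤ 4 * ((x + 1) * (y + 1)))
    (hp : ∀ x y : ℝ, 0 ≤ x → 0 ≤ y → |p x y| ≤ 1440 * ((x + 1) ^ 2 * (y + 1) ^ 2))
    (hq : ∀ x y : ℝ, 0 ≤ x → 0 ≤ y → |q x y| ≤ 1440 * ((x + 1) ^ 2 * (y + 1) ^ 2))
    (h1 : ∀ x y : ℝ, 0 ≤ x → 0 ≤ y →
      ρ x y * b x (y + 1) - b x y = σ x y * p (x + 1) y - p x y)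
    (h2 : ∀ x y : ℝ, 0 ≤ x → 0 ≤ y → ρ x y * (a + b x (y + 1) * δ x y) - a =
      σ x y * (q (x + 1) y + p (x + 1) y * ε x y) - q x y)
    (hS : Tendsto (fun N => ∑ n ∈ range N, w n 0 * (a + b n 0 * l n 0)) atTop (𝓝 S)) :
    HasSum (fun k : ℕ => w 0 k * (q 0 k + p 0 k * l 0 k)) S := by
  have hwb : ∀ n k : ℕ, w n k ≤ (1 / 4) ^ k * (1 / ((n : ℝ) + 1) ^ 3) := fun n k => by
    induction k with
    | zero => simpa using hw n
    | succ k ih =>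
      rw [hwk]
      calc w n k * ρ n k ≤ w n k * (1 / 4) :=
            mul_le_mul_of_nonneg_left (hρ _ _ n.cast_nonneg k.cast_nonneg) (hw0 n k)
        _ ≤ ((1 / 4) ^ k * (1 / ((n : ℝ) + 1) ^ 3)) * (1 / 4) := by gcongr
        _ = _ := by ring
  -- The constant is `1440 * (1 + 20)`, from the bounds on `q`, `p` and `l`.
  have key := hasSum_of_wz (F := fun n k : ℕ => w n k * (a + b n k * l n k))
    (G := fun n k : ℕ => w n k * (q n k + p n k * l n k)) (C := 30240) (S := S) ?_ ?_ ?_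
    (by simpa using hS)
  · simpa using key
  · intro n k
    have e1 := h1 n k n.cast_nonneg k.cast_nonneg
    have e2 := h2 n k n.cast_nonneg k.cast_nonneg
    simp only [hwk, hwn, hlk, hln]
    push_cast
    -- Product rule: the part proportional to `l` is the unperturbed identity, the rest is the
    -- perturbed one.
    linear_combination w n k * e2 + w n k * l n k * e1
  · intro n k
    have hn : (0 : ℝ) ≤ n := n.cast_nonneg
    have hk : (0 : ℝ) ≤ k := k.cast_nonneg
    have hx : (1 : ℝ) ≤ (n + 1) := by linarith
    have hy : (1 : ℝ) ≤ (k + 1) := by linarith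
    have hab : |a + b n k * l n k| ≤ 84 * (((n : ℝ) + 1) * ((k : ℝ) + 1) ^ 2) := by
      calc |a + b n k * l n k| ≤ |a| + |b n k| * |l n k| := by
            rw [← abs_mul]; exact abs_add_le _ _
        _ ≤ 4 * (((n : ℝ) + 1) * ((k : ℝ) + 1) ^ 2) +
            (4 * (((n : ℝ) + 1) * ((k : ℝ) + 1))) * (20 * ((k : ℝ) + 1)) := by
            have := one_le_mul_of_one_le_of_one_le hx (one_le_pow₀ hy (n := 2))
            gcongr
            · linarith
            · exact hb _ _ hn hk
            · exact hl n k
        _ = _ := by ring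
    rw [abs_mul, abs_of_nonneg (hw0 n k)]
    calc w n k * |a + b n k * l n k|
        ≤ ((1 / 4) ^ k * (1 / ((n : ℝ) + 1) ^ 3)) * (84 * (((n : ℝ) + 1) * ((k : ℝ) + 1) ^ 2)) :=
          mul_le_mul (hwb n k) hab (abs_nonneg _) (by positivity)
      _ = 84 * (((k : ℝ) + 1) ^ 2 * (1 / 4) ^ k) * (1 / ((n : ℝ) + 1) ^ 2) := by field_simp
      _ ≤ _ := by
          gcongr
          · norm_num
          · norm_num
  · intro n k
    have hn : (0 : ℝ) ≤ n := n.cast_nonneg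
    have hk : (0 : ℝ) ≤ k := k.cast_nonneg
    have hy : (1 : ℝ) ≤ (k + 1) := by linarith
    have hpq : |q n k + p n k * l n k| ≤ 30240 * (((n : ℝ) + 1) ^ 2 * ((k : ℝ) + 1) ^ 3) := by
      calc |q n k + p n k * l n k| ≤ |q n k| + |p n k| * |l n k| := by
            rw [← abs_mul]; exact abs_add_le _ _
        _ ≤ 1440 * (((n : ℝ) + 1) ^ 2 * ((k : ℝ) + 1) ^ 3) +
            (1440 * (((n : ℝ) + 1) ^ 2 * ((k : ℝ) + 1) ^ 2)) * (20 * ((k : ℝ) + 1)) := by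
            gcongr
            · refine (hq _ _ hn hk).trans ?_
              gcongr
              norm_num
            · exact hp _ _ hn hk
            · exact hl n k
        _ = _ := by ring
    rw [abs_mul, abs_of_nonneg (hw0 n k)]
    calc w n k * |q n k + p n k * l n k|
        ≤ ((1 / 4) ^ k * (1 / ((n : ℝ) + 1) ^ 3)) *
          (30240 * (((n : ℝ) + 1) ^ 2 * ((k : ℝ) + 1) ^ 3)) :=
          mul_le_mul (hwb n k) hpq (abs_nonneg _) (by positivity)
      _ = _ := by field_simp


/-! ### Power sums over all and over odd integers -/

/-- The real partial sum `∑_{j=1}^m 1 / j ^ s`. -/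
noncomputable def powSum (s m : ℕ) : ℝ := ∑ j ∈ range m, 1 / ((j : ℝ) + 1) ^ s

/-- The partial sum `∑_{j<m} 1 / (2j+1) ^ s` over odd integers. -/
noncomputable def oddPowSum (s m : ℕ) : ℝ := ∑ j ∈ range m, 1 / (2 * (j : ℝ) + 1) ^ s

theorem powSum_succ (s m : ℕ) : powSum s (m + 1) = powSum s m + 1 / ((m : ℝ) + 1) ^ s :=
  sum_range_succ _ _

theorem oddPowSum_succ (s m : ℕ) :
    oddPowSum s (m + 1) = oddPowSum s m + 1 / (2 * (m : ℝ) + 1) ^ s :=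
  sum_range_succ _ _

theorem powSum_zero (s : ℕ) : powSum s 0 = 0 := rfl

theorem oddPowSum_zero (s : ℕ) : oddPowSum s 0 = 0 := rfl

theorem powSum_two_mul (s m : ℕ) : powSum s (2 * m) = oddPowSum s m + powSum s m / 2 ^ s := by
  induction m with
  | zero => simp [powSum_zero, oddPowSum_zero]
  | succ m ih =>
    rw [show 2 * (m + 1) = 2 * m + 1 + 1 by ring, powSum_succ, powSum_succ, ih, powSum_succ,
      oddPowSum_succ]
    have : (2 * (m : ℝ) + 1 + 1) ^ s = 2 ^ s * ((m : ℝ) + 1) ^ s := by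
      rw [← mul_pow]; congr 1; ring
    push_cast
    rw [this]
    field_simp
    ring

theorem powSum_one_eq_harmonic (m : ℕ) : (harmonic m : ℝ) = powSum 1 m := by
  simp [harmonic, powSum]

theorem powSum_eq_genHarmonic (s m : ℕ) : (genHarmonic s m : ℝ) = powSum s m := by
  induction m with
  | zero => simp [genHarmonic, powSum_zero]
  | succ m ih =>
    rw [powSum_succ, ← ih]
    simp [genHarmonic, Finset.sum_Icc_succ_top]

/-- Bounds independent of the starting point `a` make the logarithmic derivatives linear in `k`,
uniformly in `n`. -/
theorem powSum_add_sub (s a j : ℕ) :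
    0 ≤ powSum s (a + j) - powSum s a ∧ powSum s (a + j) - powSum s a ≤ j := by
  induction j with
  | zero => simp
  | succ j ih =>
    have h1 : (1 : ℝ) ≤ ((a + j : ℕ) + 1 : ℝ) ^ s := one_le_pow₀ (le_add_of_nonneg_left (by positivity))
    have h2 : 1 / ((a + j : ℕ) + 1 : ℝ) ^ s ≤ 1 := (div_le_one (by positivity)).2 h1
    have h3 : 0 ≤ 1 / ((a + j : ℕ) + 1 : ℝ) ^ s := by positivity
    rw [← add_assoc, powSum_succ]
    push_cast at *
    constructor <;> linarith

theorem oddPowSum_add_sub (s a j : ℕ) :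
    0 ≤ oddPowSum s (a + j) - oddPowSum s a ∧ oddPowSum s (a + j) - oddPowSum s a ≤ j := by
  induction j with
  | zero => simp
  | succ j ih =>
    have h1 : (1 : ℝ) ≤ (2 * (a + j : ℕ) + 1 : ℝ) ^ s :=
      one_le_pow₀ (le_add_of_nonneg_left (by positivity))
    have h2 : 1 / (2 * (a + j : ℕ) + 1 : ℝ) ^ s ≤ 1 := (div_le_one (by positivity)).2 h1
    have h3 : 0 ≤ 1 / (2 * (a + j : ℕ) + 1 : ℝ) ^ s := by positivity
    rw [← add_assoc, oddPowSum_succ]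
    push_cast at *
    constructor <;> linarith

theorem powSum_nonneg (s m : ℕ) : 0 ≤ powSum s m := sum_nonneg fun _ _ => by positivity

theorem oddPowSum_nonneg (s m : ℕ) : 0 ≤ oddPowSum s m := sum_nonneg fun _ _ => by positivity

theorem tendsto_powSum {s : ℕ} {S : ℝ} (hs : s ≠ 0) (h : HasSum (fun n : ℕ => 1 / (n : ℝ) ^ s) S) :
    Tendsto (powSum s) atTop (𝓝 S) := by
  have := (hasSum_nat_add_iff' 1).2 h
  -- The dropped term at index 0 is `1 / 0 = 0`, since `s ≠ 0`.
  simp only [range_one, sum_singleton, Nat.cast_zero, zero_pow hs, div_zero, sub_zero] at this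
  refine this.tendsto_sum_nat.congr fun n => ?_
  simp [powSum]

theorem tendsto_oddPowSum {s : ℕ} {S : ℝ} (h : Tendsto (powSum s) atTop (𝓝 S)) :
    Tendsto (oddPowSum s) atTop (𝓝 (S - S / 2 ^ s)) := by
  have h2 : Tendsto (fun m => powSum s (2 * m)) atTop (𝓝 S) :=
    h.comp (tendsto_id.const_mul_atTop' (by norm_num))
  refine (h2.sub (h.div_const (2 ^ s))).congr fun m => ?_
  rw [powSum_two_mul]; ring

theorem powSum_two_le (m : ℕ) : powSum 2 m ≤ 2 := by
  have h : powSum 2 m ≤ Real.pi ^ 2 / 6 := by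
    refine (monotone_nat_of_le_succ fun n => ?_).ge_of_tendsto
      (tendsto_powSum two_ne_zero hasSum_zeta_two) m
    rw [powSum_succ]
    exact le_add_of_nonneg_right (by positivity)
  have : Real.pi ^ 2 ≤ 3.15 ^ 2 := by gcongr; exact Real.pi_lt_d2.le
  linarith

theorem oddPowSum_two_le (m : ℕ) : oddPowSum 2 m ≤ 2 := by
  have := powSum_two_mul 2 m
  have := powSum_nonneg 2 m
  have := powSum_two_le (2 * m)
  linarith

/-! ### Hypergeometric weights -/

open Nat in
/-- The first hypergeometric weight. -/
noncomputable def weightA (n k : ℕ) : ℝ :=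
  ((2 * n + 4 * k + 1)! * (n + k)! ^ 4 * k ! ^ 4 : ℝ) /
    ((n + 2 * k)! * (2 * n + 2 * k + 1)! * (n + 2 * k + 1)! ^ 3 * (2 * k)!)

open Nat in
/-- The second hypergeometric weight. -/
noncomputable def weightB (n k : ℕ) : ℝ :=
  ((n + k)! ^ 4 * (2 * n)! ^ 2 * k ! ^ 4 * (4 * k + 1)! : ℝ) /
    (n ! ^ 2 * (2 * n + 2 * k + 1)! ^ 2 * (n + 2 * k + 1)! ^ 2 * (2 * k)! ^ 2)

theorem weightA_nonneg (n k : ℕ) : 0 ≤ weightA n k := by unfold weightA; positivity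

theorem weightB_nonneg (n k : ℕ) : 0 ≤ weightB n k := by unfold weightB; positivity

theorem weightA_zero_right (n : ℕ) : weightA n 0 = 1 / ((n : ℝ) + 1) ^ 3 := by
  simp only [weightA, mul_zero, add_zero, Nat.factorial_succ n, Nat.factorial_zero]
  push_cast
  field_simp

theorem weightB_zero_right (n : ℕ) :
    weightB n 0 = 1 / ((2 * (n : ℝ) + 1) ^ 2 * ((n : ℝ) + 1) ^ 2) := by
  simp only [weightB, mul_zero, add_zero, zero_add, Nat.factorial_succ n,
    Nat.factorial_succ (2 * n), Nat.factorial_zero, Nat.factorial_one]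
  push_cast
  field_simp

theorem weightA_succ_right (n k : ℕ) : weightA n (k + 1) = weightA n k * ratioA n k := by
  have e1 : 2 * n + 4 * (k + 1) + 1 = 2 * n + 4 * k + 1 + 1 + 1 + 1 + 1 := by ring
  have e4 : 2 * (k + 1) = 2 * k + 1 + 1 := by ring
  simp only [weightA, ratioA, e1, ← add_assoc, e4, Nat.factorial_succ]
  push_cast
  field_simp
  ring

theorem weightA_succ_left (n k : ℕ) : weightA (n + 1) k = weightA n k * shiftA n k := by
  have e1 : 2 * (n + 1) + 4 * k + 1 = 2 * n + 4 * k + 1 + 1 + 1 := by ring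
  have e2 : n + 1 + 2 * k = n + 2 * k + 1 := by ring
  have e3 : 2 * (n + 1) + 2 * k + 1 = 2 * n + 2 * k + 1 + 1 + 1 := by ring
  have e4 : n + 1 + k = n + k + 1 := by ring
  simp only [weightA, shiftA, e1, e2, e3, e4, Nat.factorial_succ]
  push_cast
  field_simp
  ring

theorem weightB_succ_right (n k : ℕ) : weightB n (k + 1) = weightB n k * ratioB n k := by
  have e1 : 4 * (k + 1) + 1 = 4 * k + 1 + 1 + 1 + 1 + 1 := by ring
  have e4 : 2 * (k + 1) = 2 * k + 1 + 1 := by ring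
  simp only [weightB, ratioB, e1, ← add_assoc, e4, Nat.factorial_succ]
  push_cast
  field_simp
  ring

theorem weightB_succ_left (n k : ℕ) : weightB (n + 1) k = weightB n k * shiftB n k := by
  have e1 : 2 * (n + 1) = 2 * n + 1 + 1 := by ring
  have e2 : n + 1 + 2 * k = n + 2 * k + 1 := by ring
  have e3 : 2 * (n + 1) + 2 * k + 1 = 2 * n + 2 * k + 1 + 1 + 1 := by ring
  have e4 : n + 1 + k = n + k + 1 := by ring
  simp only [weightB, shiftB, e2, e3, e4, Nat.factorial_succ]
  simp only [e1, Nat.factorial_succ]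
  push_cast
  field_simp
  ring


/-! ### The four basic series -/

theorem abs_two_mul_add_three_mul_le {x y : ℝ} (hx : 0 ≤ x) (hy : 0 ≤ y) :
    |2 * x + 3 * y + 2| ≤ 4 * ((x + 1) * (y + 1)) := by
  rw [abs_of_nonneg (by positivity)]
  nlinarith [mul_nonneg hx hy]

theorem abs_four_mul_add_four_mul_le {x y : ℝ} (hx : 0 ≤ x) (hy : 0 ≤ y) :
    |4 * x + 4 * y + 3| ≤ 4 * ((x + 1) * (y + 1)) := by
  rw [abs_of_nonneg (by positivity)]
  nlinarith [mul_nonneg hx hy]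

theorem hasSum_companionADeriv {z : ℝ} (hz : Tendsto (powSum 3) atTop (𝓝 z)) :
    HasSum (fun k : ℕ => weightA 0 k * (companionADeriv 0 k + companionA 0 k *
      (2 * (oddPowSum 1 (2 * k + 1) - oddPowSum 1 (k + 1))
        - 3 * (powSum 1 (2 * k + 1) - powSum 1 k)))) (-4 * z) := by
  have := hasSum_of_weight (w := weightA) (a := 2) (b := fun x y => 2 * x + 3 * y + 2)
    (l := fun n k => 2 * (oddPowSum 1 (n + 2 * k + 1) - oddPowSum 1 (n + k + 1))
        - 3 * (powSum 1 (n + 2 * k + 1) - powSum 1 (n + k)))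
    (p := companionA) (q := companionADeriv) (ρ := ratioA) (σ := shiftA)
    (δ := fun x y => 2 / (2 * x + 4 * y + 3) + 2 / (2 * x + 4 * y + 5) - 2 / (2 * x + 2 * y + 3)
          - 3 * (1 / (x + 2 * y + 2) + 1 / (x + 2 * y + 3) - 1 / (x + y + 1)))
    (ε := fun x y => 2 / (2 * x + 4 * y + 3) - 2 / (2 * x + 2 * y + 3)
            - 3 * (1 / (x + 2 * y + 2) - 1 / (x + y + 1)))
    (S := -4 * z)
    weightA_nonneg (fun n => (weightA_zero_right n).le) (fun _ _ => ratioA_le)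
    weightA_succ_right weightA_succ_left
    (fun n k => by
      simp only [show n + 2 * (k + 1) + 1 = n + 2 * k + 1 + 1 + 1 by ring, ← add_assoc,
        powSum_succ, oddPowSum_succ]
      push_cast
      ring)
    (fun n k => by
      simp only [show n + 1 + 2 * k + 1 = n + 2 * k + 1 + 1 by ring,
        show n + 1 + k = n + k + 1 by ring, powSum_succ, oddPowSum_succ]
      push_cast
      ring)
    (fun n k => by
      have h1 := oddPowSum_add_sub 1 (n + k + 1) k
      have h2 := powSum_add_sub 1 (n + k) (k + 1)
      rw [show n + k + 1 + k = n + 2 * k + 1 by ring] at h1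
      rw [show n + k + (k + 1) = n + 2 * k + 1 by ring] at h2
      push_cast at h2
      rw [abs_le]
      constructor <;> linarith)
    (by norm_num) (fun _ _ => abs_two_mul_add_three_mul_le)
    (fun _ _ => abs_companionA_le) (fun _ _ => abs_companionADeriv_le)
    (fun _ _ => wzA) (fun _ _ => wzADeriv)
    (by
      -- At `k = 0` the bracket is `2 + (2n+2) * (-3/(n+1)) = -4`.
      refine (hz.const_mul (-4)).congr fun N => ?_
      rw [powSum, mul_sum]
      refine sum_congr rfl fun n _ => ?_
      simp only [mul_zero, add_zero, sub_self, powSum_succ, weightA_zero_right]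
      field_simp
      ring)
  simpa using this

/-- The deformation splits one square each of `(n+k)!`, `k!` and `(n+2k+1)!`; at `k = 0` the terms
are `2/(n+1)^4`. -/
theorem hasSum_companionASnd {z : ℝ} (hz : Tendsto (powSum 4) atTop (𝓝 z)) :
    HasSum (fun k : ℕ => weightA 0 k * (companionASnd 0 k + companionA 0 k *
      (powSum 2 (2 * k + 1) - powSum 2 k - powSum 2 k))) (2 * z) := by
  have := hasSum_of_weight (w := weightA) (a := 0) (b := fun x y => 2 * x + 3 * y + 2)
    (l := fun n k => powSum 2 (n + 2 * k + 1) - powSum 2 (n + k) - powSum 2 k)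
    (p := companionA) (q := companionASnd) (ρ := ratioA) (σ := shiftA)
    (δ := fun x y => 1 / (x + 2 * y + 2) ^ 2 + 1 / (x + 2 * y + 3) ^ 2 - 1 / (x + y + 1) ^ 2
          - 1 / (y + 1) ^ 2)
    (ε := fun x y => 1 / (x + 2 * y + 2) ^ 2 - 1 / (x + y + 1) ^ 2)
    (S := 2 * z)
    weightA_nonneg (fun n => (weightA_zero_right n).le) (fun _ _ => ratioA_le)
    weightA_succ_right weightA_succ_left
    (fun n k => by
      simp only [show n + 2 * (k + 1) + 1 = n + 2 * k + 1 + 1 + 1 by ring, ← add_assoc,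
        powSum_succ]
      push_cast
      ring)
    (fun n k => by
      simp only [show n + 1 + 2 * k + 1 = n + 2 * k + 1 + 1 by ring,
        show n + 1 + k = n + k + 1 by ring, powSum_succ]
      push_cast
      ring)
    (fun n k => by
      have h1 := powSum_two_le (n + 2 * k + 1)
      have h2 := powSum_two_le (n + k)
      have h3 := powSum_two_le k
      have h4 := powSum_nonneg 2 (n + 2 * k + 1)
      have h5 := powSum_nonneg 2 (n + k)
      have h6 := powSum_nonneg 2 k
      have h7 : (0 : ℝ) ≤ k := k.cast_nonneg
      rw [abs_le]
      constructor <;> linarith)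
    (by norm_num) (fun _ _ => abs_two_mul_add_three_mul_le)
    (fun _ _ => abs_companionA_le) (fun _ _ => abs_companionASnd_le)
    (fun _ _ => wzA) (fun _ _ => wzASnd)
    (by
      refine (hz.const_mul 2).congr fun N => ?_
      rw [powSum, mul_sum]
      refine sum_congr rfl fun n _ => ?_
      simp only [mul_zero, add_zero, powSum_succ, powSum_zero, weightA_zero_right]
      field_simp
      ring)
  simpa using this

theorem weightB_zero_right_le (n : ℕ) : weightB n 0 ≤ 1 / ((n : ℝ) + 1) ^ 3 := by
  have hn : (0 : ℝ) ≤ n := n.cast_nonneg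
  rw [weightB_zero_right]
  refine one_div_le_one_div_of_le (by positivity) ?_
  rw [← sub_nonneg]
  ring_nf
  positivity

theorem hasSum_companionBDeriv {z : ℝ} (hz : Tendsto (powSum 3) atTop (𝓝 z)) :
    HasSum (fun k : ℕ => weightB 0 k * (companionBDeriv 0 k + companionB 0 k *
      (2 * (powSum 1 k - powSum 1 (2 * k + 1)) - 4 * oddPowSum 1 (k + 1)))) (-12 * z) := by
  have := hasSum_of_weight (w := weightB) (a := 4) (b := fun x y => 4 * x + 4 * y + 3)
    (l := fun n k => 2 * (powSum 1 (n + k) - powSum 1 (n + 2 * k + 1))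
      + 4 * (oddPowSum 1 n - oddPowSum 1 (n + k + 1)))
    (p := companionB) (q := companionBDeriv) (ρ := ratioB) (σ := shiftB)
    (δ := fun x y => 2 / (x + y + 1) - 2 / (x + 2 * y + 2) - 2 / (x + 2 * y + 3)
          - 4 / (2 * x + 2 * y + 3))
    (ε := fun x y => 2 / (x + y + 1) - 2 / (x + 2 * y + 2) + 4 / (2 * x + 1)
          - 4 / (2 * x + 2 * y + 3))
    (S := -12 * z)
    weightB_nonneg weightB_zero_right_le (fun _ _ => ratioB_le)
    weightB_succ_right weightB_succ_left
    (fun n k => by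
      simp only [show n + 2 * (k + 1) + 1 = n + 2 * k + 1 + 1 + 1 by ring, ← add_assoc,
        powSum_succ, oddPowSum_succ]
      push_cast
      ring)
    (fun n k => by
      simp only [show n + 1 + 2 * k + 1 = n + 2 * k + 1 + 1 by ring,
        show n + 1 + k = n + k + 1 by ring, powSum_succ, oddPowSum_succ]
      push_cast
      ring)
    (fun n k => by
      have h1 := oddPowSum_add_sub 1 n (k + 1)
      have h2 := powSum_add_sub 1 (n + k) (k + 1)
      rw [← add_assoc] at h1
      rw [show n + k + (k + 1) = n + 2 * k + 1 by ring] at h2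
      push_cast at h1 h2
      rw [abs_le]
      constructor <;> linarith)
    (by norm_num) (fun _ _ => abs_four_mul_add_four_mul_le)
    (fun _ _ => abs_companionB_le) (fun _ _ => abs_companionBDeriv_le)
    (fun _ _ => wzB) (fun _ _ => wzBDeriv)
    (by
      -- By partial fractions the `k = 0` term is `-16/(2n+1)^3 + 2/(n+1)^3`.
      have h := ((tendsto_oddPowSum hz).const_mul (-16)).add (hz.const_mul 2)
      rw [show -16 * (z - z / 2 ^ 3) + 2 * z = -12 * z by ring] at h
      refine h.congr fun N => ?_
      rw [powSum, oddPowSum, mul_sum, mul_sum, ← sum_add_distrib]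
      refine sum_congr rfl fun n _ => ?_
      simp only [mul_zero, add_zero, powSum_succ, oddPowSum_succ, weightB_zero_right]
      field_simp
      ring)
  simpa [oddPowSum_zero, sub_eq_add_neg] using this

/-- A telescoping evaluation of a double sum with alternating squares. -/
theorem tendsto_sum_alternating :
    Tendsto (fun N => ∑ n ∈ range N, weightB n 0 *
      ((4 * (n : ℝ) + 3) * (4 * oddPowSum 2 (n + 1) - powSum 2 n)))
      atTop (𝓝 (2 * Real.pi ^ 4 / 15)) := by
  have t2 := tendsto_powSum two_ne_zero hasSum_zeta_two
  have t4 := tendsto_powSum four_ne_zero hasSum_zeta_four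
  -- With `a = 4/(2n+1)^2` and `c = 1/(n+1)^2`, the summand is `(a - c)(U + a)`, where `U` is the
  -- sum of the earlier `a - c`. It equals the increment of `U^2/2` plus `(a^2 - c^2)/2`.
  have h := (((((tendsto_oddPowSum t2).const_mul 4).sub t2).pow 2).div_const 2).add
    (((tendsto_oddPowSum t4).const_mul 8).sub (t4.div_const 2))
  rw [show (4 * (Real.pi ^ 2 / 6 - Real.pi ^ 2 / 6 / 2 ^ 2) - Real.pi ^ 2 / 6) ^ 2 / 2
    + (8 * (Real.pi ^ 4 / 90 - Real.pi ^ 4 / 90 / 2 ^ 4) - Real.pi ^ 4 / 90 / 2)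
    = 2 * Real.pi ^ 4 / 15 by ring] at h
  refine h.congr fun N => ?_
  induction N with
  | zero => simp [powSum_zero, oddPowSum_zero]
  | succ n ih =>
    rw [sum_range_succ, ← ih]
    simp only [powSum_succ, oddPowSum_succ, weightB_zero_right]
    field_simp
    ring

/-- Here `(n+k)!^2`, both squares in `k!^4`, and the square of the odd product `(2n+2k+1)!!` are
split, the last with shift `2ε`; this explains the coefficients `-1`, `-2` and `4`. -/
theorem hasSum_companionBSnd :
    HasSum (fun k : ℕ => weightB 0 k * (companionBSnd 0 k + companionB 0 k *
      (4 * oddPowSum 2 (k + 1) - powSum 2 k - 2 * powSum 2 k))) (2 * Real.pi ^ 4 / 15) := by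
  have := hasSum_of_weight (w := weightB) (a := 0) (b := fun x y => 4 * x + 4 * y + 3)
    (l := fun n k => 4 * oddPowSum 2 (n + k + 1) - powSum 2 (n + k) - 2 * powSum 2 k)
    (p := companionB) (q := companionBSnd) (ρ := ratioB) (σ := shiftB)
    (δ := fun x y => 4 / (2 * x + 2 * y + 3) ^ 2 - 1 / (x + y + 1) ^ 2 - 2 / (y + 1) ^ 2)
    (ε := fun x y => 4 / (2 * x + 2 * y + 3) ^ 2 - 1 / (x + y + 1) ^ 2)
    weightB_nonneg weightB_zero_right_le (fun _ _ => ratioB_le)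
    weightB_succ_right weightB_succ_left
    (fun n k => by
      simp only [← add_assoc, powSum_succ, oddPowSum_succ]
      push_cast
      ring)
    (fun n k => by
      simp only [show n + 1 + k = n + k + 1 by ring, powSum_succ, oddPowSum_succ]
      push_cast
      ring)
    (fun n k => by
      have h1 := oddPowSum_two_le (n + k + 1)
      have h2 := powSum_two_le (n + k)
      have h3 := powSum_two_le k
      have h4 := oddPowSum_nonneg 2 (n + k + 1)
      have h5 := powSum_nonneg 2 (n + k)
      have h6 := powSum_nonneg 2 k
      have h7 : (0 : ℝ) ≤ k := k.cast_nonneg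
      rw [abs_le]
      constructor <;> linarith)
    (by norm_num) (fun _ _ => abs_four_mul_add_four_mul_le)
    (fun _ _ => abs_companionB_le) (fun _ _ => abs_companionBSnd_le)
    (fun _ _ => wzB) (fun _ _ => wzBSnd)
    (by simpa [powSum_zero] using tendsto_sum_alternating)
  simpa using this


/-! ### Linear combinations giving the stated series -/

theorem weightA_zero_left (k : ℕ) : weightA 0 k = weightB 0 k := by
  simp only [weightA, weightB, mul_zero, zero_add, Nat.factorial_zero, Nat.factorial_succ (2 * k)]
  push_cast
  field_simp

theorem summand_succ (k : ℕ) (c : ℝ) :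
    summand (k + 1) c = weightB 0 k * (c / (8 * (2 * (k : ℝ) + 1))) := by
  have hd : (4 * ((k + 1 : ℕ) : ℝ) - 1) = 4 * (k : ℝ) + 3 := by push_cast; ring
  have e1 : 4 * (k + 1) = 4 * k + 1 + 1 + 1 + 1 := by ring
  have e2 : 2 * (k + 1) = 2 * k + 1 + 1 := by ring
  have c1 : ((4 * (k + 1)).choose (2 * (k + 1)) : ℝ) =
      ((4 * (k + 1)).factorial : ℝ) / ((2 * (k + 1)).factorial * (2 * (k + 1)).factorial) := by
    rw [Nat.cast_choose ℝ (by lia), show 4 * (k + 1) - 2 * (k + 1) = 2 * (k + 1) by lia]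
  have c2 : ((2 * (k + 1)).choose (k + 1) : ℝ) =
      ((2 * (k + 1)).factorial : ℝ) / ((k + 1).factorial * (k + 1).factorial) := by
    rw [Nat.cast_choose ℝ (by lia), show 2 * (k + 1) - (k + 1) = k + 1 by lia]
  rw [summand, hd, c1, c2, weightB, e1, e2]
  simp only [mul_zero, zero_add, Nat.factorial_zero, Nat.factorial_succ]
  push_cast
  field_simp
  ring

theorem hasSum_pnat_iff {α : Type*} [AddCommMonoid α] [TopologicalSpace α] {f : ℕ → α} {S : α} :
    HasSum (fun k : ℕ+ => f k) S ↔ HasSum (fun k : ℕ => f (k + 1)) S := by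
  rw [← Equiv.pnatEquivNat.symm.hasSum_iff]
  rfl

theorem oddPowSum_one_succ (k : ℕ) :
    oddPowSum 1 (k + 1) = powSum 1 (2 * k + 1) - powSum 1 k / 2 := by
  have h := powSum_two_mul 1 (k + 1)
  rw [show 2 * (k + 1) = 2 * k + 1 + 1 by ring, powSum_succ 1 (2 * k + 1), powSum_succ 1 k] at h
  push_cast at h
  have : 1 / (2 * (k : ℝ) + 1 + 1) = 1 / (k + 1) / 2 := by field_simp; ring
  simp only [pow_one] at h
  linarith

theorem oddPowSum_two_succ (k : ℕ) :
    oddPowSum 2 (k + 1) = powSum 2 (2 * k + 1) - powSum 2 k / 4 := by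
  have h := powSum_two_mul 2 (k + 1)
  rw [show 2 * (k + 1) = 2 * k + 1 + 1 by ring, powSum_succ 2 (2 * k + 1), powSum_succ 2 k] at h
  push_cast at h
  have : 1 / (2 * (k : ℝ) + 1 + 1) ^ 2 = 1 / (k + 1) ^ 2 / 4 := by field_simp; ring
  linarith

theorem hasSum_first {z : ℝ} (hz : Tendsto (powSum 3) atTop (𝓝 z)) :
    HasSum (fun k : ℕ+ => summand k (Q k * (3 * (harmonic (2 * (k : ℕ) - 1) : ℝ)
      - 2 * (harmonic ((k : ℕ) - 1) : ℝ)) - 34 * ((k : ℕ) : ℝ) + 25 / 2)) (6 * z) := by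
  refine (hasSum_pnat_iff (f := fun k : ℕ => summand k (Q k * (3 * (harmonic (2 * k - 1) : ℝ)
      - 2 * (harmonic (k - 1) : ℝ)) - 34 * (k : ℝ) + 25 / 2))).2 ?_
  -- With `X = H_{2k+1}` and `Y = H_k`, the harmonic factor is `4Y - 6X`; halving and negating gives
  -- `3X - 2Y`.
  have h := (hasSum_companionBDeriv hz).mul_left (-1 / 2)
  rw [show -1 / 2 * (-12 * z) = 6 * z by ring] at h
  refine h.congr_fun fun k => ?_
  rw [summand_succ, show 2 * (k + 1) - 1 = 2 * k + 1 by lia, show k + 1 - 1 = k by lia,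
    powSum_one_eq_harmonic, powSum_one_eq_harmonic, oddPowSum_one_succ]
  simp only [Q, companionBDeriv, companionB, certB, certBDeriv]
  push_cast
  field_simp
  ring

theorem hasSum_second {z : ℝ} (hz : Tendsto (powSum 3) atTop (𝓝 z)) :
    HasSum (fun k : ℕ+ => summand k (Q k * (harmonic (4 * (k : ℕ) - 1) : ℝ)
      - (304 * ((k : ℕ) : ℝ) ^ 2 - 216 * ((k : ℕ) : ℝ) + 39) /
        (4 * (4 * ((k : ℕ) : ℝ) - 1)))) (4 * z) := by
  have h1 := hasSum_first hz
  rw [hasSum_pnat_iff (f := fun k : ℕ => summand k (Q k * (3 * (harmonic (2 * k - 1) : ℝ)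
      - 2 * (harmonic (k - 1) : ℝ)) - 34 * (k : ℝ) + 25 / 2))] at h1
  refine (hasSum_pnat_iff (f := fun k : ℕ => summand k (Q k * (harmonic (4 * k - 1) : ℝ)
      - (304 * (k : ℝ) ^ 2 - 216 * (k : ℝ) + 39) / (4 * (4 * (k : ℝ) - 1))))).2 ?_
  -- All multiples of `H_k` cancel and `H_{4k+2}` remains; the missing `1/(4k+3)` goes into the
  -- rational part.
  have h := h1.add ((hasSum_companionADeriv hz).mul_left (1 / 2))
  rw [show 6 * z + 1 / 2 * (-4 * z) = 4 * z by ring] at h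
  refine h.congr_fun fun k => ?_
  have hH : powSum 1 (4 * k + 3) = oddPowSum 1 (2 * k + 1) + powSum 1 (2 * k + 1) / 2
      + 1 / (4 * k + 3) := by
    have := powSum_two_mul 1 (2 * k + 1)
    rw [show 4 * k + 3 = 2 * (2 * k + 1) + 1 by ring, powSum_succ, this]
    push_cast
    ring
  rw [summand_succ, summand_succ, show 4 * (k + 1) - 1 = 4 * k + 3 by lia,
    show 2 * (k + 1) - 1 = 2 * k + 1 by lia, show k + 1 - 1 = k by lia,
    powSum_one_eq_harmonic, powSum_one_eq_harmonic, powSum_one_eq_harmonic, hH,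
    oddPowSum_one_succ k, weightA_zero_left]
  have hd : 4 * ((k + 1 : ℕ) : ℝ) - 1 = 4 * k + 3 := by push_cast; ring
  rw [hd]
  simp only [Q, companionADeriv, companionA, certA, certADeriv]
  push_cast
  field_simp
  ring

theorem hasSum_harmonic_two :
    HasSum (fun k : ℕ+ => summand k (Q k * (genHarmonic 2 ((k : ℕ) - 1) : ℝ)
      + (44 * ((k : ℕ) : ℝ) - 15) / (4 * ((k : ℕ) : ℝ)))) (Real.pi ^ 4 / 90) := by
  refine (hasSum_pnat_iff (f := fun k : ℕ => summand k (Q k * (genHarmonic 2 (k - 1) : ℝ)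
      + (44 * (k : ℝ) - 15) / (4 * (k : ℝ))))).2 ?_
  -- With `X = H_{2k+1}^{(2)}` and `Y = H_k^{(2)}`, the factors are `4X - 4Y` and `X - 2Y`. Weights
  -- `1/4` and `-1` isolate `Y`; `1/2` and `-1` isolate `X` for the last series.
  have h := (hasSum_companionBSnd.mul_left (1 / 4)).sub
    (hasSum_companionASnd (tendsto_powSum four_ne_zero hasSum_zeta_four))
  rw [show 1 / 4 * (2 * Real.pi ^ 4 / 15) - 2 * (Real.pi ^ 4 / 90) = Real.pi ^ 4 / 90 by ring] at h
  refine h.congr_fun fun k => ?_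
  rw [summand_succ, show k + 1 - 1 = k by lia, powSum_eq_genHarmonic, oddPowSum_two_succ,
    weightA_zero_left]
  simp only [Q, companionASnd, companionA, companionBSnd, companionB, certA, certASnd, certB,
    certBSnd]
  push_cast
  field_simp
  ring

theorem hasSum_harmonic_two_double :
    HasSum (fun k : ℕ+ => summand k (Q k * (genHarmonic 2 (2 * (k : ℕ) - 1) : ℝ)
      + (52 * ((k : ℕ) : ℝ) - 21) / (4 * ((k : ℕ) : ℝ)))) (2 * Real.pi ^ 4 / 45) := by
  refine (hasSum_pnat_iff (f := fun k : ℕ => summand k (Q k * (genHarmonic 2 (2 * k - 1) : ℝ)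
      + (52 * (k : ℝ) - 21) / (4 * (k : ℝ))))).2 ?_
  have h := (hasSum_companionBSnd.mul_left (1 / 2)).sub
    (hasSum_companionASnd (tendsto_powSum four_ne_zero hasSum_zeta_four))
  rw [show 1 / 2 * (2 * Real.pi ^ 4 / 15) - 2 * (Real.pi ^ 4 / 90) = 2 * Real.pi ^ 4 / 45 by
    ring] at h
  refine h.congr_fun fun k => ?_
  rw [summand_succ, show 2 * (k + 1) - 1 = 2 * k + 1 by lia, powSum_eq_genHarmonic,
    oddPowSum_two_succ, weightA_zero_left]
  simp only [Q, companionASnd, companionA, companionBSnd, companionB, certA, certASnd, certB,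
    certBSnd]
  push_cast
  field_simp
  ring

end HarmonicSeries

theorem theorem1p15 :
    HasSum (fun k : ℕ+ => ((HarmonicSeries.summand k
        (HarmonicSeries.Q k *
            (3 * (harmonic (2 * (k : ℕ) - 1) : ℝ) - 2 * (harmonic ((k : ℕ) - 1) : ℝ))
          - 34 * ((k : ℕ) : ℝ) + 25 / 2) : ℝ) : ℂ))
      (6 * riemannZeta 3) ∧
    HasSum (fun k : ℕ+ => ((HarmonicSeries.summand k
        (HarmonicSeries.Q k * (harmonic (4 * (k : ℕ) - 1) : ℝ)
          - (304 * ((k : ℕ) : ℝ) ^ 2 - 216 * ((k : ℕ) : ℝ) + 39) /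
            (4 * (4 * ((k : ℕ) : ℝ) - 1))) : ℝ) : ℂ))
      (4 * riemannZeta 3) ∧
    HasSum (fun k : ℕ+ => HarmonicSeries.summand k
        (HarmonicSeries.Q k * (HarmonicSeries.genHarmonic 2 ((k : ℕ) - 1) : ℝ)
          + (44 * ((k : ℕ) : ℝ) - 15) / (4 * ((k : ℕ) : ℝ))))
      (Real.pi ^ 4 / 90) ∧
    HasSum (fun k : ℕ+ => HarmonicSeries.summand k
        (HarmonicSeries.Q k * (HarmonicSeries.genHarmonic 2 (2 * (k : ℕ) - 1) : ℝ)
          + (52 * ((k : ℕ) : ℝ) - 21) / (4 * ((k : ℕ) : ℝ))))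
      (2 * Real.pi ^ 4 / 45) := by
  have hs : Summable fun n : ℕ => 1 / (n : ℝ) ^ 3 := Real.summable_one_div_nat_pow.2 (by norm_num)
  have hz := HarmonicSeries.tendsto_powSum three_ne_zero hs.hasSum
  have hzeta : riemannZeta 3 = ((∑' n : ℕ, 1 / (n : ℝ) ^ 3 : ℝ) : ℂ) := by
    have := zeta_nat_eq_tsum_of_gt_one (k := 3) (by norm_num)
    push_cast at this ⊢
    exact this
  rw [hzeta]
  refine ⟨?_, ?_, HarmonicSeries.hasSum_harmonic_two, HarmonicSeries.hasSum_harmonic_two_double⟩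
  · exact_mod_cast Complex.hasSum_ofReal.2 (HarmonicSeries.hasSum_first hz)
  · exact_mod_cast Complex.hasSum_ofReal.2 (HarmonicSeries.hasSum_second hz)
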